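/- Let $(M_1,g_1)$ and $(M_2,g_2)$ be smooth, complete, connected (finite-dimensional, second countable) Riemannian manifolds with Riemannian distances $d_1,d_2$, and let $U_1\subset M_1$, $U_2\subset M_2$ be open and geodesically convex: any two points of $U_i$ are joined by a unique minimizing geodesic of $M_i$, and it stays in $U_i$. Equip $M=M_1\times M_2$ with the product metric $g_1+g_2$ and the distance $d((x,y),(\bar x,\bar y))=\sqrt{d_1(x,\bar x)^2+d_2(y,\bar y)^2}$, and put $U=U_1\times U_2$. On each of the three manifolds $N=M_1,M_2,M$, with distance $d_N$ and open set $V=U_1,U_2,U$ respectively, consider the aggregation equation $\partial_t\rho-\nabla\cdot(\rho\,\nabla K*\rho)=0$ with the quadratic potential $K(z,\bar z)=\tfrac12 d_N(z,\bar z)^2$. Its velocity field is $v[\rho](z,t)=-\int_V\nabla K_{\bar z}(z)\,d\rho_t(\bar z)$, where $K_{\bar z}=K(\cdot,\bar z)$. Let $\mathcal P_1(V)$ be the set of Borel probability measures on $V$ with finite first moment, $W_1$ the $1$-Wasserstein distance associated with $d_N$, and $C([0,\infty);\mathcal P_1(V))$ the set of $W_1$-continuous curves. A curve $(\rho_t)_{t\ge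 0}$ is a global weak solution on $V$ if $v[\rho]$ generates a unique flow map $\Psi:\operatorname{supp}(\rho_0)\times[0,\infty)\to V$, that is, $\partial_t\Psi^t(z)=v[\rho](\Psi^t(z),t)$ and $\Psi^0(z)=z$ for all $z\in\operatorname{supp}(\rho_0)$ and $t\ge 0$, and if $\rho_t=\Psi^t\#\rho_0$ for all $t\ge 0$. Suppose that, for $i=1,2$, $\rho^i$ is a global weak solution on $U_i$ in $C([0,\infty);\mathcal P_1(U_i))$, unique among such curves with its initial datum. Suppose that there are $p\in U_1$ and $q\in U_2$ with $W_1(\rho^1_t,\delta_p)\to 0$ and $W_1(\rho^2_t,\delta_q)\to 0$ as $t\to\infty$, and that there are $\bar t>0$ and compact sets $Q_1\subset U_1$, $Q_2\subset U_2$ with $\operatorname{supp}(\rho^1_t)\subset Q_1$ and $\operatorname{supp}(\rho^2_t)\subset Q_2$ for all $t\ge\bar t$. Then $\mu_t:=\rho^1_t\otimes\rho^2_t$ is the unique global weak solution on $U$ in $C([0,\infty);\mathcal P_1(U))$ with initial datum $\rho^1_0\otimes\rho^2_0$, and $W_1(\mu_t,\delta_{(p,q)})\to 0$ as $t\to\infty$.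 -/

import Mathlib

open Set Filter Topology MeasureTheory Manifold Bundle
open scoped ENNReal ContDiff

noncomputable section

namespace Aggregation

/-! ### The product metric `g₁ + g₂` on a product of Riemannian manifolds -/

section ProductMetric

variable {E₁ E₂ : Type*} [NormedAddCommGroup E₁] [NormedSpace ℝ E₁]
  [NormedAddCommGroup E₂] [NormedSpace ℝ E₂]
  {H₁ H₂ : Type*} [TopologicalSpace H₁] [TopologicalSpace H₂]
  {I₁ : ModelWithCorners ℝ E₁ H₁} {I₂ : ModelWithCorners ℝ E₂ H₂}
  {M₁ M₂ : Type*} [TopologicalSpace M₁] [ChartedSpace H₁ M₁]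
  [TopologicalSpace M₂] [ChartedSpace H₂ M₂]
  [RiemannianBundle (fun x : M₁ => TangentSpace I₁ x)]
  [RiemannianBundle (fun x : M₂ => TangentSpace I₂ x)]

variable (I₁ I₂) in
/-- The inner product `⟨v, w⟩ = ⟨v₁, w₁⟩ + ⟨v₂, w₂⟩` on `T_(x,y)(M₁ × M₂) = T_x M₁ × T_y M₂`. -/
def prodInner (z : M₁ × M₂) :
    (TangentSpace I₁ z.1 × TangentSpace I₂ z.2) →L[ℝ]
      (TangentSpace I₁ z.1 × TangentSpace I₂ z.2) →L[ℝ] ℝ :=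
  (innerSL ℝ (E := TangentSpace I₁ z.1)).bilinearComp
      (ContinuousLinearMap.fst ℝ _ _) (ContinuousLinearMap.fst ℝ _ _)
    + (innerSL ℝ (E := TangentSpace I₂ z.2)).bilinearComp
      (ContinuousLinearMap.snd ℝ _ _) (ContinuousLinearMap.snd ℝ _ _)

theorem prodInner_apply (z : M₁ × M₂) (v w : TangentSpace I₁ z.1 × TangentSpace I₂ z.2) :
    prodInner I₁ I₂ z v w = inner ℝ v.1 w.1 + inner ℝ v.2 w.2 := rfl

theorem prodInner_symm (z : M₁ × M₂) (v w : TangentSpace I₁ z.1 × TangentSpace I₂ z.2) :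
    prodInner I₁ I₂ z v w = prodInner I₁ I₂ z w v := by
  rw [prodInner_apply, prodInner_apply, real_inner_comm, real_inner_comm v.2]

theorem prodInner_pos (z : M₁ × M₂) (v : TangentSpace I₁ z.1 × TangentSpace I₂ z.2)
    (hv : v ≠ 0) : 0 < prodInner I₁ I₂ z v v := by
  rw [prodInner_apply, real_inner_self_eq_norm_sq, real_inner_self_eq_norm_sq]
  by_cases h : v.1 = 0
  · have h2 : v.2 ≠ 0 := fun h2 => hv (Prod.ext h h2)
    have := norm_pos_iff.2 h2
    positivity
  · have := norm_pos_iff.2 h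
    positivity

theorem prodInner_isVonNBounded (z : M₁ × M₂) :
    Bornology.IsVonNBounded ℝ
      {v : TangentSpace I₁ z.1 × TangentSpace I₂ z.2 | prodInner I₁ I₂ z v v < 1} := by
  refine (NormedSpace.isVonNBounded_ball ℝ
    (TangentSpace I₁ z.1 × TangentSpace I₂ z.2) 1).subset ?_
  intro v hv
  have hv' : prodInner I₁ I₂ z v v < 1 := hv
  rw [prodInner_apply, real_inner_self_eq_norm_sq, real_inner_self_eq_norm_sq] at hv'
  rw [mem_ball_zero_iff, Prod.norm_def, max_lt_iff]
  constructor
  · nlinarith [norm_nonneg v.1, sq_nonneg ‖v.2‖]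
  · nlinarith [norm_nonneg v.2, sq_nonneg ‖v.1‖]

/-- The product Riemannian metric on `M₁ × M₂`. -/
instance prodRiemannianBundle :
    RiemannianBundle (fun z : M₁ × M₂ => TangentSpace (I₁.prod I₂) z) where
  g := {
    inner := fun z => prodInner I₁ I₂ z
    symm := fun z v w => prodInner_symm z v w
    pos := fun z v hv => prodInner_pos z v hv
    continuousAt := fun z => by
      have h : Continuous (fun v : TangentSpace I₁ z.1 × TangentSpace I₂ z.2 =>
          prodInner I₁ I₂ z v v) := by fun_prop
      exact h.continuousAt
    isVonNBounded := fun z => prodInner_isVonNBounded z }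

/-- The inner product on the tangent spaces of the product is the sum of the inner products. -/
theorem inner_prod_tangentSpace (z : M₁ × M₂) (v w : TangentSpace (I₁.prod I₂) z) :
    inner ℝ v w = inner ℝ (show TangentSpace I₁ z.1 from v.1) (show TangentSpace I₁ z.1 from w.1)
      + inner ℝ (show TangentSpace I₂ z.2 from v.2) (show TangentSpace I₂ z.2 from w.2) := rfl

end ProductMetric

/-- The product distance `d((x,y),(x',y')) = √(d₁(x,x')² + d₂(y,y')²)`. The `dist` that Mathlib puts
on a product type is the maximum of the two distances instead; it has the same topology. -/
def prodDist {M₁ M₂ : Type*} [MetricSpace M₁] [MetricSpace M₂] (z w : M₁ × M₂) : ℝ :=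
  √(dist z.1 w.1 ^ 2 + dist z.2 w.2 ^ 2)

/-! ### Geodesically convex sets -/

section Geodesic

variable {M : Type*} [MetricSpace M]

/-- `γ`, restricted to `[0, 1]`, is a minimizing geodesic from `x` to `y`, parametrized with
constant speed. -/
structure IsMinimizingGeodesic (γ : ℝ → M) (x y : M) : Prop where
  start : γ 0 = x
  finish : γ 1 = y
  dist_eq : ∀ s ∈ Icc (0 : ℝ) 1, ∀ t ∈ Icc (0 : ℝ) 1, dist (γ s) (γ t) = |s - t| * dist x y

/-- Any two points of `U` are joined by a unique minimizing geodesic of `M`, and it stays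
in `U`. -/
def GeodesicallyConvex (U : Set M) : Prop :=
  ∀ x ∈ U, ∀ y ∈ U, ∃ γ : ℝ → M, IsMinimizingGeodesic γ x y ∧ (∀ t ∈ Icc (0 : ℝ) 1, γ t ∈ U) ∧
    ∀ γ' : ℝ → M, IsMinimizingGeodesic γ' x y → EqOn γ' γ (Icc 0 1)

end Geodesic

/-! ### Probability measures on `U` and the `1`-Wasserstein distance

A measure on the open set `U ⊆ M` is a measure on `M` that gives no mass to the complement of `U`. -/

section Wasserstein

variable {M : Type*} [MeasurableSpace M]

/-- The `1`-Wasserstein distance for the distance `d`: the infimum of the transport cost over all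
couplings of `ρ` and `σ`. -/
def wasserstein1 (d : M → M → ℝ) (ρ σ : Measure M) : ℝ≥0∞ :=
  ⨅ κ ∈ {κ : Measure (M × M) | κ.map Prod.fst = ρ ∧ κ.map Prod.snd = σ},
    ∫⁻ z, ENNReal.ofReal (d z.1 z.2) ∂κ

/-- `ρ ∈ 𝒫₁(U)`. -/
structure IsP1 (d : M → M → ℝ) (U : Set M) (ρ : Measure M) : Prop where
  isProbabilityMeasure : IsProbabilityMeasure ρ
  compl_null : ρ Uᶜ = 0
  finite_moment : ∃ x₀ ∈ U, ∫⁻ x, ENNReal.ofReal (d x₀ x) ∂ρ < ⊤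

/-- `ρ ∈ C([0, ∞); 𝒫₁(U))`, where `𝒫₁(U)` carries the metric `W₁`. Only the values `ρ t` with
`0 ≤ t` matter. -/
structure IsP1Curve (d : M → M → ℝ) (U : Set M) (ρ : ℝ → Measure M) : Prop where
  isP1 : ∀ t, 0 ≤ t → IsP1 d U (ρ t)
  continuous : ∀ t, 0 ≤ t →
    Tendsto (fun s => wasserstein1 d (ρ s) (ρ t)) (𝓝[Ici 0] t) (𝓝 0)

/-- The support of `ρ`, as a measure on the space `U`. -/
def suppIn [TopologicalSpace M] (U : Set M) (ρ : Measure M) : Set M := U ∩ ρ.support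

end Wasserstein

/-! ### The aggregation model -/

/-- The quadratic interaction potential `K(x, y) = d(x, y)² / 2`. -/
def quadraticPotential {M : Type*} (d : M → M → ℝ) (x y : M) : ℝ := d x y ^ 2 / 2

section Model

variable {E : Type*} [NormedAddCommGroup E] [NormedSpace ℝ E] [FiniteDimensional ℝ E]
  {H : Type*} [TopologicalSpace H] (I : ModelWithCorners ℝ E H)
  {M : Type*} [TopologicalSpace M] [ChartedSpace H M]
  [RiemannianBundle (fun x : M => TangentSpace I x)]

instance finiteDimensional_tangentSpace (x : M) : FiniteDimensional ℝ (TangentSpace I x) :=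
  inferInstanceAs (FiniteDimensional ℝ E)

instance completeSpace_tangentSpace (x : M) : CompleteSpace (TangentSpace I x) :=
  FiniteDimensional.complete ℝ _

/-- The Riemannian gradient: `⟨gradient f x, w⟩_x = df_x(w)`. -/
def gradient (f : M → ℝ) (x : M) : TangentSpace I x :=
  (InnerProductSpace.toDual ℝ (TangentSpace I x)).symm (mfderiv I 𝓘(ℝ, ℝ) f x)

theorem inner_gradient (f : M → ℝ) (x : M) (w : TangentSpace I x) :
    inner ℝ (gradient I f x) w = mfderiv I 𝓘(ℝ, ℝ) f x w :=
  InnerProductSpace.toDual_symm_apply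

variable [MeasurableSpace M]

/-- The velocity field `v[ρ](x, t) = -(∇K * ρ_t)(x) = -∫ ∇K_y(x) dρ_t(y)`, where
`K_y = K(·, y)`. -/
def velocity (K : M → M → ℝ) (ρ : ℝ → Measure M) (t : ℝ) (x : M) : TangentSpace I x :=
  -∫ y, gradient I (fun x' => K x' y) x ∂(ρ t)

/-- The velocity field `v[ρ]` is defined on `U × [0, ∞)`: the gradients and the integrals in it
exist. For the quadratic potential, a geodesically convex open `U` and `ρ_t ∈ 𝒫₁(U)` this is always
the case, as then `∇K_y(x) = -log_x y` has norm `d(x, y)`. -/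
structure VelocityDefined (K : M → M → ℝ) (U : Set M) (ρ : ℝ → Measure M) : Prop where
  differentiable : ∀ x ∈ U, ∀ y ∈ U, MDifferentiableAt I 𝓘(ℝ, ℝ) (fun x' => K x' y) x
  integrable : ∀ t, 0 ≤ t → ∀ x ∈ U, Integrable (fun y => gradient I (fun x' => K x' y) x) (ρ t)

/-- `Ψ : S × [0, ∞) → U` is a global flow map generated by the time-dependent vector field `X`
and `S`. The values `Ψ x t` with `x ∉ S` or `t < 0` do not matter. -/
structure IsFlowMap (X : ℝ → (x : M) → TangentSpace I x) (U S : Set M) (Ψ : M → ℝ → M) : Prop where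
  initial : ∀ x ∈ S, Ψ x 0 = x
  mem : ∀ x ∈ S, ∀ t, 0 ≤ t → Ψ x t ∈ U
  deriv : ∀ x ∈ S, ∀ t, 0 ≤ t →
    HasMFDerivWithinAt 𝓘(ℝ, ℝ) I (Ψ x) (Ici 0) t
      ((1 : ℝ →L[ℝ] ℝ).smulRight (X t (Ψ x t)))

/-- `ρ` is a global weak solution on `U` of `∂ₜρ - ∇·(ρ ∇K * ρ) = 0`: its velocity field generates
a unique flow map `Ψ` on `supp ρ₀ × [0, ∞)`, and `ρ_t` is the push-forward of `ρ₀` by `Ψ(·, t)`. -/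
structure IsWeakSolution (K : M → M → ℝ) (U : Set M) (ρ : ℝ → Measure M) : Prop where
  velocityDefined : VelocityDefined I K U ρ
  exists_flow : ∃ Ψ : M → ℝ → M,
    IsFlowMap I (velocity I K ρ) U (suppIn U (ρ 0)) Ψ ∧
    (∀ Ψ' : M → ℝ → M, IsFlowMap I (velocity I K ρ) U (suppIn U (ρ 0)) Ψ' →
      ∀ x ∈ suppIn U (ρ 0), ∀ t, 0 ≤ t → Ψ' x t = Ψ x t) ∧
    ∀ t, 0 ≤ t → ρ t = (ρ 0).map (fun x => Ψ x t)

/-- `ρ` is the unique global weak solution, among the curves in `C([0, ∞); 𝒫₁(U))` that start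
from `ρ₀`. -/
structure IsUniqueSolution (d K : M → M → ℝ) (U : Set M) (ρ : ℝ → Measure M) : Prop where
  isP1Curve : IsP1Curve d U ρ
  isWeakSolution : IsWeakSolution I K U ρ
  unique : ∀ σ : ℝ → Measure M, IsP1Curve d U σ → IsWeakSolution I K U σ → σ 0 = ρ 0 →
    ∀ t, 0 ≤ t → σ t = ρ t

end Model

end Aggregation

end

noncomputable section

namespace Aggregation

/-! ### Product measures -/

section ProductMeasures

variable {α β γ δ : Type*} [MeasurableSpace α] [MeasurableSpace β] [MeasurableSpace γ]
  [MeasurableSpace δ]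

theorem prod_map_of_aemeasurable {μ : Measure α} {ν : Measure β} [SFinite μ] [SFinite ν]
    {f : α → γ} {g : β → δ} (hf : AEMeasurable f μ) (hg : AEMeasurable g ν) :
    (μ.map f).prod (ν.map g) = (μ.prod ν).map (Prod.map f g) := by
  have h : Prod.map f g =ᵐ[μ.prod ν] Prod.map (hf.mk f) (hg.mk g) := by
    filter_upwards [Measure.quasiMeasurePreserving_fst.ae hf.ae_eq_mk,
      Measure.quasiMeasurePreserving_snd.ae hg.ae_eq_mk] with z h₁ h₂
    exact Prod.ext h₁ h₂
  rw [Measure.map_congr h, Measure.map_congr hf.ae_eq_mk, Measure.map_congr hg.ae_eq_mk,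
    Measure.map_prod_map _ _ hf.measurable_mk hg.measurable_mk]

theorem aemeasurable_of_prodMap [MeasurableSpace.CountablyGenerated γ]
    [MeasurableSpace.CountablyGenerated δ] {μ : Measure α} {ν : Measure β}
    [IsProbabilityMeasure μ] [IsProbabilityMeasure ν] {f : α → γ} {g : β → δ}
    (h : AEMeasurable (Prod.map f g) (μ.prod ν)) : AEMeasurable f μ ∧ AEMeasurable g ν :=
  ⟨(Measure.nullMeasurable_comp_fst.1 (measurable_fst.comp_aemeasurable h).nullMeasurable).aemeasurable,
    (Measure.nullMeasurable_comp_snd.1 (measurable_snd.comp_aemeasurable h).nullMeasurable).aemeasurable⟩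

theorem aemeasurable_of_isProbabilityMeasure_map {μ : Measure α} {f : α → β}
    (h : IsProbabilityMeasure (μ.map f)) : AEMeasurable f μ := by
  by_contra hf
  rw [Measure.map_of_not_aemeasurable hf] at h
  exact zero_ne_one (α := ℝ≥0∞) h.measure_univ

variable [TopologicalSpace α] [TopologicalSpace β]

theorem support_prod (μ : Measure α) (ν : Measure β) [SFinite μ] [SFinite ν] :
    (μ.prod ν).support = μ.support ×ˢ ν.support := by
  ext ⟨x, y⟩
  simp only [mem_prod, Measure.mem_support_iff_forall]
  refine ⟨fun h => ⟨fun V hV => ?_, fun V hV => ?_⟩, fun h V hV => ?_⟩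
  · have := h _ (prod_mem_nhds hV univ_mem)
    rw [Measure.prod_prod] at this
    exact pos_of_ne_zero fun h0 => by simp [h0] at this
  · have := h _ (prod_mem_nhds univ_mem hV)
    rw [Measure.prod_prod] at this
    exact pos_of_ne_zero fun h0 => by simp [h0] at this
  · obtain ⟨V₁, hV₁, V₂, hV₂, hV⟩ := mem_nhds_prod_iff.1 hV
    refine lt_of_lt_of_le ?_ (measure_mono hV)
    rw [Measure.prod_prod]
    exact ENNReal.mul_pos (h.1 V₁ hV₁).ne' (h.2 V₂ hV₂).ne'

theorem suppIn_prod (μ : Measure α) (ν : Measure β) [SFinite μ] [SFinite ν]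
    (U₁ : Set α) (U₂ : Set β) :
    suppIn (U₁ ×ˢ U₂) (μ.prod ν) = suppIn U₁ μ ×ˢ suppIn U₂ ν := by
  rw [suppIn, support_prod, prod_inter_prod, suppIn, suppIn]

theorem ae_mem_suppIn [HereditarilyLindelofSpace α] {μ : Measure α} {U : Set α}
    (h : μ Uᶜ = 0) : ∀ᵐ x ∂μ, x ∈ suppIn U μ := by
  filter_upwards [compl_mem_ae_iff.2 h, Measure.support_mem_ae (μ := μ)] with x h₁ h₂
  exact ⟨by simpa using h₁, h₂⟩

theorem suppIn_nonempty [HereditarilyLindelofSpace α] {μ : Measure α} [IsProbabilityMeasure μ]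
    {U : Set α} (h : μ Uᶜ = 0) : (suppIn U μ).Nonempty :=
  (ae_mem_suppIn h).exists

end ProductMeasures

/-! ### The `1`-Wasserstein distance on a product -/

section ProductWasserstein

variable {M₁ M₂ : Type*} [MetricSpace M₁] [MetricSpace M₂]

theorem dist_fst_le_prodDist (z w : M₁ × M₂) : dist z.1 w.1 ≤ prodDist z w :=
  Real.le_sqrt_of_sq_le (le_add_of_nonneg_right (sq_nonneg _))

theorem dist_snd_le_prodDist (z w : M₁ × M₂) : dist z.2 w.2 ≤ prodDist z w :=
  Real.le_sqrt_of_sq_le (le_add_of_nonneg_left (sq_nonneg _))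

theorem prodDist_le_add (z w : M₁ × M₂) : prodDist z w ≤ dist z.1 w.1 + dist z.2 w.2 := by
  refine Real.sqrt_le_iff.2 ⟨by positivity, ?_⟩
  nlinarith [mul_nonneg (dist_nonneg (x := z.1) (y := w.1)) (dist_nonneg (x := z.2) (y := w.2))]

theorem ofReal_prodDist_le_add (z w : M₁ × M₂) :
    ENNReal.ofReal (prodDist z w)
      ≤ ENNReal.ofReal (dist z.1 w.1) + ENNReal.ofReal (dist z.2 w.2) :=
  (ENNReal.ofReal_le_ofReal (prodDist_le_add z w)).trans ENNReal.ofReal_add_le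

theorem quadraticPotential_prodDist :
    quadraticPotential (prodDist : M₁ × M₂ → M₁ × M₂ → ℝ) = fun z w =>
      quadraticPotential dist z.1 w.1 + quadraticPotential dist z.2 w.2 := by
  funext z w
  rw [quadraticPotential, prodDist, Real.sq_sqrt (by positivity), add_div]
  rfl

variable [MeasurableSpace M₁] [MeasurableSpace M₂]

theorem wasserstein1_fst_le (ρ σ : Measure (M₁ × M₂)) :
    wasserstein1 dist ρ.fst σ.fst ≤ wasserstein1 prodDist ρ σ := by
  refine le_iInf₂ fun κ hκ => ?_
  have hm : Measurable (Prod.map Prod.fst Prod.fst : (M₁ × M₂) × (M₁ × M₂) → M₁ × M₁) :=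
    measurable_fst.prodMap measurable_fst
  refine (iInf₂_le (κ.map (Prod.map Prod.fst Prod.fst)) ⟨?_, ?_⟩).trans
    ((lintegral_map_le _ _).trans
      (lintegral_mono fun z => ENNReal.ofReal_le_ofReal (dist_fst_le_prodDist z.1 z.2)))
  · rw [Measure.map_map measurable_fst hm, Measure.fst, ← hκ.1,
      Measure.map_map measurable_fst measurable_fst]
    rfl
  · rw [Measure.map_map measurable_snd hm, Measure.fst, ← hκ.2,
      Measure.map_map measurable_fst measurable_snd]
    rfl

theorem wasserstein1_snd_le (ρ σ : Measure (M₁ × M₂)) :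
    wasserstein1 dist ρ.snd σ.snd ≤ wasserstein1 prodDist ρ σ := by
  refine le_iInf₂ fun κ hκ => ?_
  have hm : Measurable (Prod.map Prod.snd Prod.snd : (M₁ × M₂) × (M₁ × M₂) → M₂ × M₂) :=
    measurable_snd.prodMap measurable_snd
  refine (iInf₂_le (κ.map (Prod.map Prod.snd Prod.snd)) ⟨?_, ?_⟩).trans
    ((lintegral_map_le _ _).trans
      (lintegral_mono fun z => ENNReal.ofReal_le_ofReal (dist_snd_le_prodDist z.1 z.2)))
  · rw [Measure.map_map measurable_fst hm, Measure.snd, ← hκ.1,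
      Measure.map_map measurable_snd measurable_fst]
    rfl
  · rw [Measure.map_map measurable_snd hm, Measure.snd, ← hκ.2,
      Measure.map_map measurable_snd measurable_snd]
    rfl

theorem IsP1.fst {U₁ : Set M₁} {U₂ : Set M₂} {σ : Measure (M₁ × M₂)} (hU₁ : MeasurableSet U₁)
    (h : IsP1 prodDist (U₁ ×ˢ U₂) σ) : IsP1 dist U₁ σ.fst := by
  have := h.isProbabilityMeasure
  obtain ⟨z₀, hz₀, hfin⟩ := h.finite_moment
  refine ⟨inferInstance, ?_, z₀.1, hz₀.1, lt_of_le_of_lt ((lintegral_map_le _ _).trans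
    (lintegral_mono fun z => ENNReal.ofReal_le_ofReal (dist_fst_le_prodDist z₀ z))) hfin⟩
  rw [Measure.fst_apply hU₁.compl]
  exact measure_mono_null (compl_subset_compl.2 fun z hz => hz.1) h.compl_null

theorem IsP1.snd {U₁ : Set M₁} {U₂ : Set M₂} {σ : Measure (M₁ × M₂)} (hU₂ : MeasurableSet U₂)
    (h : IsP1 prodDist (U₁ ×ˢ U₂) σ) : IsP1 dist U₂ σ.snd := by
  have := h.isProbabilityMeasure
  obtain ⟨z₀, hz₀, hfin⟩ := h.finite_moment
  refine ⟨inferInstance, ?_, z₀.2, hz₀.2, lt_of_le_of_lt ((lintegral_map_le _ _).trans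
    (lintegral_mono fun z => ENNReal.ofReal_le_ofReal (dist_snd_le_prodDist z₀ z))) hfin⟩
  rw [Measure.snd_apply hU₂.compl]
  exact measure_mono_null (compl_subset_compl.2 fun z hz => hz.2) h.compl_null

theorem IsP1Curve.fst {U₁ : Set M₁} {U₂ : Set M₂} {σ : ℝ → Measure (M₁ × M₂)}
    (hU₁ : MeasurableSet U₁) (h : IsP1Curve prodDist (U₁ ×ˢ U₂) σ) :
    IsP1Curve dist U₁ (fun t => (σ t).fst) :=
  ⟨fun t ht => (h.isP1 t ht).fst hU₁, fun t ht => tendsto_of_tendsto_of_tendsto_of_le_of_le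
    tendsto_const_nhds (h.continuous t ht) (fun _ => zero_le) fun _ => wasserstein1_fst_le _ _⟩

theorem IsP1Curve.snd {U₁ : Set M₁} {U₂ : Set M₂} {σ : ℝ → Measure (M₁ × M₂)}
    (hU₂ : MeasurableSet U₂) (h : IsP1Curve prodDist (U₁ ×ˢ U₂) σ) :
    IsP1Curve dist U₂ (fun t => (σ t).snd) :=
  ⟨fun t ht => (h.isP1 t ht).snd hU₂, fun t ht => tendsto_of_tendsto_of_tendsto_of_le_of_le
    tendsto_const_nhds (h.continuous t ht) (fun _ => zero_le) fun _ => wasserstein1_snd_le _ _⟩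

variable [SecondCountableTopology M₁] [SecondCountableTopology M₂]
  [OpensMeasurableSpace M₁] [OpensMeasurableSpace M₂]

theorem lintegral_prod_add {α β : Type*} [MeasurableSpace α] [MeasurableSpace β]
    {μ : Measure α} {ν : Measure β} [IsProbabilityMeasure μ] [IsProbabilityMeasure ν]
    {f : α → ℝ≥0∞} {g : β → ℝ≥0∞} (hf : Measurable f) (hg : Measurable g) :
    ∫⁻ z, (f z.1 + g z.2) ∂(μ.prod ν) = ∫⁻ x, f x ∂μ + ∫⁻ y, g y ∂ν := by
  rw [lintegral_add_left (f := fun z : α × β => f z.1) (hf.comp measurable_fst),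
    measurePreserving_fst.lintegral_comp hf, measurePreserving_snd.lintegral_comp hg]

theorem wasserstein1_prod_le (ρ₁ σ₁ : Measure M₁) (ρ₂ σ₂ : Measure M₂)
    [IsProbabilityMeasure ρ₁] [IsProbabilityMeasure ρ₂] :
    wasserstein1 prodDist (ρ₁.prod ρ₂) (σ₁.prod σ₂)
      ≤ wasserstein1 dist ρ₁ σ₁ + wasserstein1 dist ρ₂ σ₂ := by
  simp only [wasserstein1, ENNReal.iInf_add, ENNReal.add_iInf]
  refine le_iInf₂ fun κ₂ h₂ => le_iInf₂ fun κ₁ h₁ => ?_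
  have hκ₁ : IsProbabilityMeasure κ₁ :=
    ⟨by rw [← measure_univ (μ := ρ₁), ← h₁.1, Measure.map_apply measurable_fst .univ, preimage_univ]⟩
  have hκ₂ : IsProbabilityMeasure κ₂ :=
    ⟨by rw [← measure_univ (μ := ρ₂), ← h₂.1, Measure.map_apply measurable_fst .univ, preimage_univ]⟩
  let s : (M₁ × M₁) × (M₂ × M₂) → (M₁ × M₂) × (M₁ × M₂) :=
    fun z => ((z.1.1, z.2.1), (z.1.2, z.2.2))
  have hs : Measurable s := by fun_prop
  refine (iInf₂_le ((κ₁.prod κ₂).map s) ⟨?_, ?_⟩).trans ((lintegral_map_le _ _).trans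
    ((lintegral_mono fun z => ofReal_prodDist_le_add _ _).trans
      (lintegral_prod_add (f := fun z : M₁ × M₁ => ENNReal.ofReal (dist z.1 z.2))
        (g := fun z : M₂ × M₂ => ENNReal.ofReal (dist z.1 z.2))
        (by fun_prop) (by fun_prop)).le))
  · rw [Measure.map_map measurable_fst hs, ← h₁.1, ← h₂.1,
      Measure.map_prod_map _ _ measurable_fst measurable_fst]
    rfl
  · rw [Measure.map_map measurable_snd hs, ← h₁.2, ← h₂.2,
      Measure.map_prod_map _ _ measurable_snd measurable_snd]
    rfl

theorem IsP1.prod {U₁ : Set M₁} {U₂ : Set M₂} {ρ₁ : Measure M₁} {ρ₂ : Measure M₂}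
    (h₁ : IsP1 dist U₁ ρ₁) (h₂ : IsP1 dist U₂ ρ₂) :
    IsP1 prodDist (U₁ ×ˢ U₂) (ρ₁.prod ρ₂) := by
  have := h₁.isProbabilityMeasure
  have := h₂.isProbabilityMeasure
  obtain ⟨x, hx, hx'⟩ := h₁.finite_moment
  obtain ⟨y, hy, hy'⟩ := h₂.finite_moment
  refine ⟨inferInstance, Measure.measure_prod_compl_eq_zero h₁.compl_null h₂.compl_null, (x, y),
    ⟨hx, hy⟩, ((lintegral_mono fun z => ofReal_prodDist_le_add _ _).trans
      (lintegral_prod_add (f := fun z => ENNReal.ofReal (dist x z))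
        (g := fun z => ENNReal.ofReal (dist y z))
        (by fun_prop) (by fun_prop)).le).trans_lt (ENNReal.add_lt_top.2 ⟨hx', hy'⟩)⟩

theorem tendsto_wasserstein1_prod {ι : Type*} {l : Filter ι}
    {ρ₁ : ι → Measure M₁} {ρ₂ : ι → Measure M₂} {σ₁ : Measure M₁} {σ₂ : Measure M₂}
    (hρ₁ : ∀ᶠ t in l, IsProbabilityMeasure (ρ₁ t)) (hρ₂ : ∀ᶠ t in l, IsProbabilityMeasure (ρ₂ t))
    (h₁ : Tendsto (fun t => wasserstein1 dist (ρ₁ t) σ₁) l (𝓝 0))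
    (h₂ : Tendsto (fun t => wasserstein1 dist (ρ₂ t) σ₂) l (𝓝 0)) :
    Tendsto (fun t => wasserstein1 prodDist ((ρ₁ t).prod (ρ₂ t)) (σ₁.prod σ₂)) l (𝓝 0) := by
  have h := h₁.add h₂
  rw [add_zero] at h
  refine tendsto_of_tendsto_of_tendsto_of_le_of_le' tendsto_const_nhds h
    (Eventually.of_forall fun _ => zero_le) ?_
  filter_upwards [hρ₁, hρ₂] with t _ _
  exact wasserstein1_prod_le _ _ _ _

theorem IsP1Curve.prod {U₁ : Set M₁} {U₂ : Set M₂} {ρ₁ : ℝ → Measure M₁} {ρ₂ : ℝ → Measure M₂}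
    (h₁ : IsP1Curve dist U₁ ρ₁) (h₂ : IsP1Curve dist U₂ ρ₂) :
    IsP1Curve prodDist (U₁ ×ˢ U₂) (fun t => (ρ₁ t).prod (ρ₂ t)) :=
  ⟨fun t ht => (h₁.isP1 t ht).prod (h₂.isP1 t ht), fun t ht =>
    tendsto_wasserstein1_prod
      (eventually_mem_nhdsWithin.mono fun s hs => (h₁.isP1 s hs).isProbabilityMeasure)
      (eventually_mem_nhdsWithin.mono fun s hs => (h₂.isP1 s hs).isProbabilityMeasure)
      (h₁.continuous t ht) (h₂.continuous t ht)⟩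

end ProductWasserstein

/-! ### Flow lines -/

section FlowLines

variable {E : Type*} [NormedAddCommGroup E] [NormedSpace ℝ E]
  {H : Type*} [TopologicalSpace H] (I : ModelWithCorners ℝ E H)
  {M : Type*} [TopologicalSpace M] [ChartedSpace H M]

/-- `γ : [0, ∞) → U` is an integral curve of the time-dependent vector field `X` that starts
at `x`. -/
structure IsFlowLine (X : ℝ → (x : M) → TangentSpace I x) (U : Set M) (x : M) (γ : ℝ → M) :
    Prop where
  initial : γ 0 = x
  mem : ∀ t, 0 ≤ t → γ t ∈ U
  deriv : ∀ t, 0 ≤ t →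
    HasMFDerivWithinAt 𝓘(ℝ, ℝ) I γ (Ici 0) t ((1 : ℝ →L[ℝ] ℝ).smulRight (X t (γ t)))

/-- `Ψ` is the only flow map generated by `X` and `S`, expressed through its flow lines. -/
structure IsUniqueFlowMap (X : ℝ → (x : M) → TangentSpace I x) (U S : Set M) (Ψ : M → ℝ → M) :
    Prop where
  isFlowLine : ∀ x ∈ S, IsFlowLine I X U x (Ψ x)
  unique : ∀ x ∈ S, ∀ γ, IsFlowLine I X U x γ → ∀ t, 0 ≤ t → γ t = Ψ x t

variable {I}

theorem isFlowMap_iff {X : ℝ → (x : M) → TangentSpace I x} {U S : Set M} {Ψ : M → ℝ → M} :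
    IsFlowMap I X U S Ψ ↔ ∀ x ∈ S, IsFlowLine I X U x (Ψ x) :=
  ⟨fun h x hx => ⟨h.initial x hx, h.mem x hx, h.deriv x hx⟩, fun h =>
    ⟨fun x hx => (h x hx).initial, fun x hx => (h x hx).mem, fun x hx => (h x hx).deriv⟩⟩

theorem isUniqueFlowMap_iff {X : ℝ → (x : M) → TangentSpace I x} {U S : Set M} {Ψ : M → ℝ → M} :
    IsUniqueFlowMap I X U S Ψ ↔ IsFlowMap I X U S Ψ ∧
      ∀ Ψ' : M → ℝ → M, IsFlowMap I X U S Ψ' → ∀ x ∈ S, ∀ t, 0 ≤ t → Ψ' x t = Ψ x t := by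
  classical
  simp only [isFlowMap_iff]
  refine ⟨fun h => ⟨h.isFlowLine, fun Ψ' hΨ' x hx => h.unique x hx _ (hΨ' x hx)⟩,
    fun h => ⟨h.1, fun x hx γ hγ t ht => ?_⟩⟩
  have := h.2 (Function.update Ψ x γ) (fun y hy => ?_) x hx t ht
  · rwa [Function.update_self] at this
  · by_cases hyx : y = x
    · subst hyx
      rwa [Function.update_self]
    · rw [Function.update_of_ne hyx]
      exact h.1 y hy

end FlowLines

section Product

variable {E₁ E₂ : Type*} [NormedAddCommGroup E₁] [NormedSpace ℝ E₁]
  [NormedAddCommGroup E₂] [NormedSpace ℝ E₂]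
  {H₁ H₂ : Type*} [TopologicalSpace H₁] [TopologicalSpace H₂]
  {I₁ : ModelWithCorners ℝ E₁ H₁} {I₂ : ModelWithCorners ℝ E₂ H₂}
  {M₁ M₂ : Type*} [TopologicalSpace M₁] [ChartedSpace H₁ M₁]
  [TopologicalSpace M₂] [ChartedSpace H₂ M₂]

section ProductFlow

variable {X₁ : ℝ → (x : M₁) → TangentSpace I₁ x} {X₂ : ℝ → (x : M₂) → TangentSpace I₂ x}
  {X : ℝ → (z : M₁ × M₂) → TangentSpace (I₁.prod I₂) z} {U₁ : Set M₁} {U₂ : Set M₂}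

theorem isFlowLine_prod_iff (hX : ∀ t, 0 ≤ t → ∀ z ∈ U₁ ×ˢ U₂, X t z = (X₁ t z.1, X₂ t z.2))
    {z : M₁ × M₂} {γ : ℝ → M₁ × M₂} :
    IsFlowLine (I₁.prod I₂) X (U₁ ×ˢ U₂) z γ ↔
      IsFlowLine I₁ X₁ U₁ z.1 (fun t => (γ t).1) ∧
        IsFlowLine I₂ X₂ U₂ z.2 (fun t => (γ t).2) := by
  refine ⟨fun h => ⟨⟨congrArg Prod.fst h.initial, fun t ht => (h.mem t ht).1, fun t ht => ?_⟩,
    ⟨congrArg Prod.snd h.initial, fun t ht => (h.mem t ht).2, fun t ht => ?_⟩⟩,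
    fun h => ⟨Prod.ext h.1.initial h.2.initial, fun t ht => ⟨h.1.mem t ht, h.2.mem t ht⟩,
      fun t ht => ?_⟩⟩
  · have hd := h.deriv t ht
    rw [hX t ht _ (h.mem t ht)] at hd
    exact (hasMFDerivAt_fst (I := I₁) (I' := I₂) (γ t)).comp_hasMFDerivWithinAt t hd
  · have hd := h.deriv t ht
    rw [hX t ht _ (h.mem t ht)] at hd
    exact (hasMFDerivAt_snd (I := I₁) (I' := I₂) (γ t)).comp_hasMFDerivWithinAt t hd
  · rw [hX t ht _ ⟨h.1.mem t ht, h.2.mem t ht⟩]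
    exact (h.1.deriv t ht).prodMk (h.2.deriv t ht)

theorem IsUniqueFlowMap.prod
    (hX : ∀ t, 0 ≤ t → ∀ z ∈ U₁ ×ˢ U₂, X t z = (X₁ t z.1, X₂ t z.2))
    {S₁ : Set M₁} {S₂ : Set M₂} {Ψ₁ : M₁ → ℝ → M₁} {Ψ₂ : M₂ → ℝ → M₂}
    (h₁ : IsUniqueFlowMap I₁ X₁ U₁ S₁ Ψ₁) (h₂ : IsUniqueFlowMap I₂ X₂ U₂ S₂ Ψ₂) :
    IsUniqueFlowMap (I₁.prod I₂) X (U₁ ×ˢ U₂) (S₁ ×ˢ S₂)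
      (fun z t => (Ψ₁ z.1 t, Ψ₂ z.2 t)) where
  isFlowLine z hz := (isFlowLine_prod_iff hX).2 ⟨h₁.isFlowLine _ hz.1, h₂.isFlowLine _ hz.2⟩
  unique z hz γ hγ t ht := by
    have h := (isFlowLine_prod_iff hX).1 hγ
    exact Prod.ext (h₁.unique _ hz.1 _ h.1 t ht) (h₂.unique _ hz.2 _ h.2 t ht)

/-- A unique flow map of a vector field that splits is a product of unique flow maps: exchanging
one component of a flow line for that of another flow line gives a flow line. -/
theorem IsUniqueFlowMap.exists_prod
    (hX : ∀ t, 0 ≤ t → ∀ z ∈ U₁ ×ˢ U₂, X t z = (X₁ t z.1, X₂ t z.2))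
    {S₁ : Set M₁} {S₂ : Set M₂} (hS₁ : S₁.Nonempty) (hS₂ : S₂.Nonempty)
    {Φ : M₁ × M₂ → ℝ → M₁ × M₂}
    (h : IsUniqueFlowMap (I₁.prod I₂) X (U₁ ×ˢ U₂) (S₁ ×ˢ S₂) Φ) :
    ∃ (Ψ₁ : M₁ → ℝ → M₁) (Ψ₂ : M₂ → ℝ → M₂), IsUniqueFlowMap I₁ X₁ U₁ S₁ Ψ₁ ∧
      IsUniqueFlowMap I₂ X₂ U₂ S₂ Ψ₂ ∧
      ∀ z ∈ S₁ ×ˢ S₂, ∀ t, 0 ≤ t → Φ z t = (Ψ₁ z.1 t, Ψ₂ z.2 t) := by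
  obtain ⟨a, ha⟩ := hS₁
  obtain ⟨b, hb⟩ := hS₂
  have hΦ z (hz : z ∈ S₁ ×ˢ S₂) := (isFlowLine_prod_iff hX).1 (h.isFlowLine z hz)
  refine ⟨fun x t => (Φ (x, b) t).1, fun y t => (Φ (a, y) t).2,
    ⟨fun x hx => (hΦ (x, b) ⟨hx, hb⟩).1, fun x hx γ hγ t ht => ?_⟩,
    ⟨fun y hy => (hΦ (a, y) ⟨ha, hy⟩).2, fun y hy γ hγ t ht => ?_⟩, fun z hz t ht => ?_⟩
  · exact congrArg Prod.fst (h.unique (x, b) ⟨hx, hb⟩ (fun t => (γ t, (Φ (x, b) t).2))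
      ((isFlowLine_prod_iff hX).2 ⟨hγ, (hΦ (x, b) ⟨hx, hb⟩).2⟩) t ht)
  · exact congrArg Prod.snd (h.unique (a, y) ⟨ha, hy⟩ (fun t => ((Φ (a, y) t).1, γ t))
      ((isFlowLine_prod_iff hX).2 ⟨(hΦ (a, y) ⟨ha, hy⟩).1, hγ⟩) t ht)
  · exact (h.unique z hz (fun t => ((Φ (z.1, b) t).1, (Φ (a, z.2) t).2))
      ((isFlowLine_prod_iff hX).2
        ⟨(hΦ (z.1, b) ⟨hz.1, hb⟩).1, (hΦ (a, z.2) ⟨ha, hz.2⟩).2⟩) t ht).symm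

end ProductFlow

/-! ### Gradients and velocity fields on a product -/

theorem mdifferentiableAt_add_prod {f : M₁ → ℝ} {g : M₂ → ℝ} {z : M₁ × M₂}
    (hf : MDifferentiableAt I₁ 𝓘(ℝ, ℝ) f z.1) (hg : MDifferentiableAt I₂ 𝓘(ℝ, ℝ) g z.2) :
    MDifferentiableAt (I₁.prod I₂) 𝓘(ℝ, ℝ) (fun w => f w.1 + g w.2) z :=
  ((HasMFDerivAt.comp (I' := I₁) z hf.hasMFDerivAt (hasMFDerivAt_fst z)).add
      (HasMFDerivAt.comp (I' := I₂) z hg.hasMFDerivAt (hasMFDerivAt_snd z))).mdifferentiableAt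

variable [RiemannianBundle (fun x : M₁ => TangentSpace I₁ x)]
  [RiemannianBundle (fun x : M₂ => TangentSpace I₂ x)]

variable {α : Type*} [MeasurableSpace α] {μ : Measure α}

theorem integrable_tangentSpace_prod_iff {z : M₁ × M₂} {F : α → TangentSpace (I₁.prod I₂) z} :
    Integrable F μ ↔
      Integrable (fun a => (show TangentSpace I₁ z.1 from (F a).1)) μ ∧
        Integrable (fun a => (show TangentSpace I₂ z.2 from (F a).2)) μ := by
  let p₁ : TangentSpace (I₁.prod I₂) z →L[ℝ] TangentSpace I₁ z.1 :=
    ContinuousLinearMap.fst ℝ (TangentSpace I₁ z.1) (TangentSpace I₂ z.2)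
  let p₂ : TangentSpace (I₁.prod I₂) z →L[ℝ] TangentSpace I₂ z.2 :=
    ContinuousLinearMap.snd ℝ (TangentSpace I₁ z.1) (TangentSpace I₂ z.2)
  let i₁ : TangentSpace I₁ z.1 →L[ℝ] TangentSpace (I₁.prod I₂) z :=
    ContinuousLinearMap.inl ℝ (TangentSpace I₁ z.1) (TangentSpace I₂ z.2)
  let i₂ : TangentSpace I₂ z.2 →L[ℝ] TangentSpace (I₁.prod I₂) z :=
    ContinuousLinearMap.inr ℝ (TangentSpace I₁ z.1) (TangentSpace I₂ z.2)
  refine ⟨fun h => ⟨p₁.integrable_comp h, p₂.integrable_comp h⟩, fun h => ?_⟩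
  refine ((i₁.integrable_comp h.1).add (i₂.integrable_comp h.2)).congr
    (Eventually.of_forall fun a => ?_)
  exact Prod.ext (add_zero _) (zero_add _)

variable [FiniteDimensional ℝ E₁] [FiniteDimensional ℝ E₂]

theorem integral_tangentSpace_prod {z : M₁ × M₂} {F : α → TangentSpace (I₁.prod I₂) z}
    (hF : Integrable F μ) :
    ∫ a, F a ∂μ = (∫ a, (show TangentSpace I₁ z.1 from (F a).1) ∂μ,
      ∫ a, (show TangentSpace I₂ z.2 from (F a).2) ∂μ) := by
  let p₁ : TangentSpace (I₁.prod I₂) z →L[ℝ] TangentSpace I₁ z.1 :=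
    ContinuousLinearMap.fst ℝ (TangentSpace I₁ z.1) (TangentSpace I₂ z.2)
  let p₂ : TangentSpace (I₁.prod I₂) z →L[ℝ] TangentSpace I₂ z.2 :=
    ContinuousLinearMap.snd ℝ (TangentSpace I₁ z.1) (TangentSpace I₂ z.2)
  exact Prod.ext (p₁.integral_comp_comm hF).symm (p₂.integral_comp_comm hF).symm

theorem gradient_prod {f : M₁ → ℝ} {g : M₂ → ℝ} {z : M₁ × M₂}
    (hf : MDifferentiableAt I₁ 𝓘(ℝ, ℝ) f z.1) (hg : MDifferentiableAt I₂ 𝓘(ℝ, ℝ) g z.2) :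
    gradient (I₁.prod I₂) (fun w => f w.1 + g w.2) z
      = (gradient I₁ f z.1, gradient I₂ g z.2) := by
  have h : HasMFDerivAt (I₁.prod I₂) 𝓘(ℝ, ℝ) (fun w : M₁ × M₂ => f w.1 + g w.2) z _ :=
    (HasMFDerivAt.comp (I' := I₁) z hf.hasMFDerivAt (hasMFDerivAt_fst z)).add
      (HasMFDerivAt.comp (I' := I₂) z hg.hasMFDerivAt (hasMFDerivAt_snd z))
  refine ext_inner_right ℝ fun w => ?_
  rw [inner_gradient, h.mfderiv]
  exact (congrArg₂ (· + ·) (inner_gradient I₁ f z.1 w.1) (inner_gradient I₂ g z.2 w.2)).symm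

end Product

/-! ### Weak solutions on a product -/

section ProductSolutions

variable {E₁ E₂ : Type*} [NormedAddCommGroup E₁] [NormedSpace ℝ E₁] [FiniteDimensional ℝ E₁]
  [NormedAddCommGroup E₂] [NormedSpace ℝ E₂] [FiniteDimensional ℝ E₂]
  {H₁ H₂ : Type*} [TopologicalSpace H₁] [TopologicalSpace H₂]
  {I₁ : ModelWithCorners ℝ E₁ H₁} {I₂ : ModelWithCorners ℝ E₂ H₂}
  {M₁ M₂ : Type*} [TopologicalSpace M₁] [ChartedSpace H₁ M₁]
  [TopologicalSpace M₂] [ChartedSpace H₂ M₂]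
  [RiemannianBundle (fun x : M₁ => TangentSpace I₁ x)]
  [RiemannianBundle (fun x : M₂ => TangentSpace I₂ x)]
  [MeasurableSpace M₁] [MeasurableSpace M₂]
  {K₁ : M₁ → M₁ → ℝ} {K₂ : M₂ → M₂ → ℝ} {U₁ : Set M₁} {U₂ : Set M₂}

theorem isWeakSolution_iff {E H M : Type*} [NormedAddCommGroup E] [NormedSpace ℝ E]
    [FiniteDimensional ℝ E] [TopologicalSpace H] {I : ModelWithCorners ℝ E H}
    [TopologicalSpace M] [ChartedSpace H M] [RiemannianBundle (fun x : M => TangentSpace I x)]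
    [MeasurableSpace M] {K : M → M → ℝ} {U : Set M} {ρ : ℝ → Measure M} :
    IsWeakSolution I K U ρ ↔ VelocityDefined I K U ρ ∧ ∃ Ψ : M → ℝ → M,
      IsUniqueFlowMap I (velocity I K ρ) U (suppIn U (ρ 0)) Ψ ∧
      ∀ t, 0 ≤ t → ρ t = (ρ 0).map (fun x => Ψ x t) := by
  simp only [isUniqueFlowMap_iff, and_assoc]
  exact ⟨fun h => ⟨h.1, h.2⟩, fun h => ⟨h.1, h.2⟩⟩

variable (hK₁ : ∀ x ∈ U₁, ∀ y ∈ U₁, MDifferentiableAt I₁ 𝓘(ℝ, ℝ) (fun x' => K₁ x' y) x)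
  (hK₂ : ∀ x ∈ U₂, ∀ y ∈ U₂, MDifferentiableAt I₂ 𝓘(ℝ, ℝ) (fun x' => K₂ x' y) x)

include hK₁ hK₂

theorem gradient_ae_eq_prod {σ : Measure (M₁ × M₂)} (hσ : σ (U₁ ×ˢ U₂)ᶜ = 0) {z : M₁ × M₂}
    (hz : z ∈ U₁ ×ˢ U₂) :
    (fun w : M₁ × M₂ => gradient (I₁.prod I₂) (fun z' => K₁ z'.1 w.1 + K₂ z'.2 w.2) z) =ᵐ[σ]
      fun w => (gradient I₁ (fun x => K₁ x w.1) z.1, gradient I₂ (fun x => K₂ x w.2) z.2) := by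
  filter_upwards [compl_mem_ae_iff.2 hσ] with w hw
  rw [compl_compl] at hw
  exact gradient_prod (hK₁ _ hz.1 _ hw.1) (hK₂ _ hz.2 _ hw.2)

theorem integrable_gradient_prod_iff {σ : Measure (M₁ × M₂)} (hσ : σ (U₁ ×ˢ U₂)ᶜ = 0)
    {z : M₁ × M₂} (hz : z ∈ U₁ ×ˢ U₂) :
    Integrable (fun w : M₁ × M₂ =>
        gradient (I₁.prod I₂) (fun z' => K₁ z'.1 w.1 + K₂ z'.2 w.2) z) σ ↔
      Integrable (fun w => gradient I₁ (fun x => K₁ x w.1) z.1) σ ∧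
        Integrable (fun w => gradient I₂ (fun x => K₂ x w.2) z.2) σ :=
  (integrable_congr (gradient_ae_eq_prod hK₁ hK₂ hσ hz)).trans integrable_tangentSpace_prod_iff

theorem velocity_prod {σ : ℝ → Measure (M₁ × M₂)} (hσ : ∀ t, 0 ≤ t → σ t (U₁ ×ˢ U₂)ᶜ = 0)
    (hv : VelocityDefined (I₁.prod I₂) (fun z w => K₁ z.1 w.1 + K₂ z.2 w.2) (U₁ ×ˢ U₂) σ) :
    ∀ t, 0 ≤ t → ∀ z ∈ U₁ ×ˢ U₂,
      velocity (I₁.prod I₂) (fun z w => K₁ z.1 w.1 + K₂ z.2 w.2) σ t z =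
        (-∫ w, gradient I₁ (fun x => K₁ x w.1) z.1 ∂(σ t),
          -∫ w, gradient I₂ (fun x => K₂ x w.2) z.2 ∂(σ t)) := by
  intro t ht z hz
  have h := gradient_ae_eq_prod hK₁ hK₂ (hσ t ht) hz
  rw [velocity, integral_congr_ae h,
    integral_tangentSpace_prod ((integrable_congr h).1 (hv.integrable t ht z hz))]
  rfl

theorem velocity_prod_measure {ρ₁ : ℝ → Measure M₁} {ρ₂ : ℝ → Measure M₂}
    {σ : ℝ → Measure (M₁ × M₂)} (hσ : ∀ t, 0 ≤ t → σ t (U₁ ×ˢ U₂)ᶜ = 0)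
    (hv : VelocityDefined (I₁.prod I₂) (fun z w => K₁ z.1 w.1 + K₂ z.2 w.2) (U₁ ×ˢ U₂) σ)
    (hρ₁ : ∀ t, 0 ≤ t → IsProbabilityMeasure (ρ₁ t))
    (hρ₂ : ∀ t, 0 ≤ t → IsProbabilityMeasure (ρ₂ t))
    (hσρ : ∀ t, 0 ≤ t → σ t = (ρ₁ t).prod (ρ₂ t)) :
    ∀ t, 0 ≤ t → ∀ z ∈ U₁ ×ˢ U₂,
      velocity (I₁.prod I₂) (fun z w => K₁ z.1 w.1 + K₂ z.2 w.2) σ t z =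
        (velocity I₁ K₁ ρ₁ t z.1, velocity I₂ K₂ ρ₂ t z.2) := by
  intro t ht z hz
  have := hρ₁ t ht
  have := hρ₂ t ht
  rw [velocity_prod hK₁ hK₂ hσ hv t ht z hz, hσρ t ht,
    integral_fun_fst (fun y => gradient I₁ (fun x => K₁ x y) z.1),
    integral_fun_snd (fun y => gradient I₂ (fun x => K₂ x y) z.2)]
  simp only [probReal_univ, one_smul]
  rfl

omit hK₁ hK₂

theorem IsWeakSolution.prod {ρ₁ : ℝ → Measure M₁} {ρ₂ : ℝ → Measure M₂}
    (h₁ : IsWeakSolution I₁ K₁ U₁ ρ₁) (h₂ : IsWeakSolution I₂ K₂ U₂ ρ₂)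
    (hρ₁ : ∀ t, 0 ≤ t → IsProbabilityMeasure (ρ₁ t) ∧ ρ₁ t U₁ᶜ = 0)
    (hρ₂ : ∀ t, 0 ≤ t → IsProbabilityMeasure (ρ₂ t) ∧ ρ₂ t U₂ᶜ = 0) :
    IsWeakSolution (I₁.prod I₂) (fun z w => K₁ z.1 w.1 + K₂ z.2 w.2) (U₁ ×ˢ U₂)
      (fun t => (ρ₁ t).prod (ρ₂ t)) := by
  obtain ⟨hv₁, Ψ₁, hΨ₁, hm₁⟩ := isWeakSolution_iff.1 h₁
  obtain ⟨hv₂, Ψ₂, hΨ₂, hm₂⟩ := isWeakSolution_iff.1 h₂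
  have hnull : ∀ t, 0 ≤ t → (ρ₁ t).prod (ρ₂ t) (U₁ ×ˢ U₂)ᶜ = 0 := fun t ht => by
    have := (hρ₁ t ht).1
    have := (hρ₂ t ht).1
    exact Measure.measure_prod_compl_eq_zero (hρ₁ t ht).2 (hρ₂ t ht).2
  have hv : VelocityDefined (I₁.prod I₂) (fun z w => K₁ z.1 w.1 + K₂ z.2 w.2) (U₁ ×ˢ U₂)
      (fun t => (ρ₁ t).prod (ρ₂ t)) := by
    refine ⟨fun z hz w hw => mdifferentiableAt_add_prod (hv₁.differentiable _ hz.1 _ hw.1)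
      (hv₂.differentiable _ hz.2 _ hw.2), fun t ht z hz => ?_⟩
    have := (hρ₁ t ht).1
    have := (hρ₂ t ht).1
    exact (integrable_gradient_prod_iff hv₁.differentiable hv₂.differentiable (hnull t ht) hz).2
      ⟨(hv₁.integrable t ht _ hz.1).comp_fst _, (hv₂.integrable t ht _ hz.2).comp_snd _⟩
  have := (hρ₁ 0 le_rfl).1
  have := (hρ₂ 0 le_rfl).1
  refine isWeakSolution_iff.2 ⟨hv, fun z t => (Ψ₁ z.1 t, Ψ₂ z.2 t), ?_, fun t ht => ?_⟩
  · rw [suppIn_prod]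
    exact hΨ₁.prod (velocity_prod_measure hv₁.differentiable hv₂.differentiable hnull hv
      (fun t ht => (hρ₁ t ht).1) (fun t ht => (hρ₂ t ht).1) fun t _ => rfl) hΨ₂
  · have h₁ := (hρ₁ t ht).1
    have h₂ := (hρ₂ t ht).1
    rw [hm₁ t ht] at h₁ ⊢
    rw [hm₂ t ht] at h₂ ⊢
    exact prod_map_of_aemeasurable (aemeasurable_of_isProbabilityMeasure_map h₁)
      (aemeasurable_of_isProbabilityMeasure_map h₂)

include hK₁ hK₂

theorem IsWeakSolution.fst_snd [SecondCountableTopology M₁] [SecondCountableTopology M₂]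
    [BorelSpace M₁] [BorelSpace M₂] {σ : ℝ → Measure (M₁ × M₂)}
    (h : IsWeakSolution (I₁.prod I₂) (fun z w => K₁ z.1 w.1 + K₂ z.2 w.2) (U₁ ×ˢ U₂) σ)
    (hσ : ∀ t, 0 ≤ t → IsProbabilityMeasure (σ t) ∧ σ t (U₁ ×ˢ U₂)ᶜ = 0)
    {ρ₁ : Measure M₁} {ρ₂ : Measure M₂} [IsProbabilityMeasure ρ₁] [IsProbabilityMeasure ρ₂]
    (hρ₁ : ρ₁ U₁ᶜ = 0) (hρ₂ : ρ₂ U₂ᶜ = 0) (h0 : σ 0 = ρ₁.prod ρ₂) :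
    (∀ t, 0 ≤ t → σ t = (σ t).fst.prod (σ t).snd) ∧
      IsWeakSolution I₁ K₁ U₁ (fun t => (σ t).fst) ∧
      IsWeakSolution I₂ K₂ U₂ (fun t => (σ t).snd) := by
  obtain ⟨hv, Φ, hΦ, hm⟩ := isWeakSolution_iff.1 h
  have hprob := fun t ht => (hσ t ht).1
  have hnull := fun t ht => (hσ t ht).2
  have hf0 : (σ 0).fst = ρ₁ := by rw [h0, Measure.fst_prod]
  have hs0 : (σ 0).snd = ρ₂ := by rw [h0, Measure.snd_prod]
  have hS₁ := suppIn_nonempty hρ₁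
  have hS₂ := suppIn_nonempty hρ₂
  rw [h0, suppIn_prod] at hΦ
  have hmap : ∀ (Ψ₁ : M₁ → ℝ → M₁) (Ψ₂ : M₂ → ℝ → M₂),
      (∀ z ∈ suppIn U₁ ρ₁ ×ˢ suppIn U₂ ρ₂, ∀ t, 0 ≤ t → Φ z t = (Ψ₁ z.1 t, Ψ₂ z.2 t)) →
      ∀ t, 0 ≤ t → (σ t).fst = ρ₁.map (fun x => Ψ₁ x t) ∧ (σ t).snd = ρ₂.map (fun x => Ψ₂ x t) ∧
        σ t = (ρ₁.map (fun x => Ψ₁ x t)).prod (ρ₂.map (fun x => Ψ₂ x t)) := by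
    intro Ψ₁ Ψ₂ hΨ t ht
    have hae : (fun z => Φ z t) =ᵐ[ρ₁.prod ρ₂]
        Prod.map (fun x => Ψ₁ x t) (fun x => Ψ₂ x t) := by
      filter_upwards [Measure.quasiMeasurePreserving_fst.ae (ae_mem_suppIn hρ₁),
        Measure.quasiMeasurePreserving_snd.ae (ae_mem_suppIn hρ₂)] with z h₁ h₂
      exact hΨ z ⟨h₁, h₂⟩ t ht
    have hσt := hm t ht
    rw [h0, Measure.map_congr hae] at hσt
    have hmeas := aemeasurable_of_prodMap (aemeasurable_of_isProbabilityMeasure_map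
      (hσt ▸ hprob t ht))
    rw [← prod_map_of_aemeasurable hmeas.1 hmeas.2] at hσt
    have := Measure.isProbabilityMeasure_map hmeas.1
    have := Measure.isProbabilityMeasure_map hmeas.2
    exact ⟨by rw [hσt, Measure.fst_prod], by rw [hσt, Measure.snd_prod], hσt⟩
  have hprod : ∀ t, 0 ≤ t → σ t = (σ t).fst.prod (σ t).snd := by
    obtain ⟨Ψ₁, Ψ₂, -, -, hΨ⟩ := hΦ.exists_prod
      (X₁ := fun t x => -∫ w, gradient I₁ (fun x' => K₁ x' w.1) x ∂(σ t))
      (X₂ := fun t x => -∫ w, gradient I₂ (fun x' => K₂ x' w.2) x ∂(σ t))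
      (velocity_prod hK₁ hK₂ hnull hv) hS₁ hS₂
    intro t ht
    obtain ⟨h₁, h₂, h₁₂⟩ := hmap Ψ₁ Ψ₂ hΨ t ht
    rwa [← h₁, ← h₂] at h₁₂
  have hpf : ∀ t, 0 ≤ t → IsProbabilityMeasure (σ t).fst := fun t ht => by
    have := hprob t ht
    infer_instance
  have hps : ∀ t, 0 ≤ t → IsProbabilityMeasure (σ t).snd := fun t ht => by
    have := hprob t ht
    infer_instance
  obtain ⟨Ψ₁, Ψ₂, hΨ₁, hΨ₂, hΨ⟩ := hΦ.exists_prod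
    (velocity_prod_measure hK₁ hK₂ hnull hv hpf hps hprod) hS₁ hS₂
  have hint : ∀ t, 0 ≤ t → ∀ z ∈ U₁ ×ˢ U₂,
      Integrable (fun y => gradient I₁ (fun x => K₁ x y) z.1) (σ t).fst ∧
        Integrable (fun y => gradient I₂ (fun x => K₂ x y) z.2) (σ t).snd := by
    intro t ht z hz
    have := hpf t ht
    have := hps t ht
    have hi := (integrable_gradient_prod_iff hK₁ hK₂ (hnull t ht) hz).1 (hv.integrable t ht z hz)
    rw [hprod t ht] at hi
    exact ⟨Integrable.of_comp_fst (f := fun y => gradient I₁ (fun x => K₁ x y) z.1) hi.1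
        (IsProbabilityMeasure.ne_zero _),
      Integrable.of_comp_snd (f := fun y => gradient I₂ (fun x => K₂ x y) z.2) hi.2
        (IsProbabilityMeasure.ne_zero _)⟩
  refine ⟨hprod, isWeakSolution_iff.2 ⟨⟨hK₁, fun t ht x hx => ?_⟩, Ψ₁, ?_, fun t ht => ?_⟩,
    isWeakSolution_iff.2 ⟨⟨hK₂, fun t ht y hy => ?_⟩, Ψ₂, ?_, fun t ht => ?_⟩⟩
  · obtain ⟨y, hy⟩ := hS₂
    exact (hint t ht (x, y) ⟨hx, hy.1⟩).1
  · rwa [hf0]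
  · rw [hf0]
    exact (hmap Ψ₁ Ψ₂ hΨ t ht).1
  · obtain ⟨x, hx⟩ := hS₁
    exact (hint t ht (x, y) ⟨hx.1, hy⟩).2
  · rwa [hs0]
  · rw [hs0]
    exact (hmap Ψ₁ Ψ₂ hΨ t ht).2.1

end ProductSolutions

theorem IsUniqueSolution.prod
    {E₁ E₂ : Type*} [NormedAddCommGroup E₁] [NormedSpace ℝ E₁] [FiniteDimensional ℝ E₁]
    [NormedAddCommGroup E₂] [NormedSpace ℝ E₂] [FiniteDimensional ℝ E₂]
    {H₁ H₂ : Type*} [TopologicalSpace H₁] [TopologicalSpace H₂]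
    {I₁ : ModelWithCorners ℝ E₁ H₁} {I₂ : ModelWithCorners ℝ E₂ H₂}
    {M₁ M₂ : Type*} [MetricSpace M₁] [ChartedSpace H₁ M₁] [MetricSpace M₂] [ChartedSpace H₂ M₂]
    [RiemannianBundle (fun x : M₁ => TangentSpace I₁ x)]
    [RiemannianBundle (fun x : M₂ => TangentSpace I₂ x)]
    [SecondCountableTopology M₁] [SecondCountableTopology M₂]
    [MeasurableSpace M₁] [MeasurableSpace M₂] [BorelSpace M₁] [BorelSpace M₂]
    {K₁ : M₁ → M₁ → ℝ} {K₂ : M₂ → M₂ → ℝ} {U₁ : Set M₁} {U₂ : Set M₂}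
    (hU₁ : MeasurableSet U₁) (hU₂ : MeasurableSet U₂)
    {ρ₁ : ℝ → Measure M₁} {ρ₂ : ℝ → Measure M₂}
    (h₁ : IsUniqueSolution I₁ dist K₁ U₁ ρ₁) (h₂ : IsUniqueSolution I₂ dist K₂ U₂ ρ₂) :
    IsUniqueSolution (I₁.prod I₂) prodDist (fun z w => K₁ z.1 w.1 + K₂ z.2 w.2) (U₁ ×ˢ U₂)
      (fun t => (ρ₁ t).prod (ρ₂ t)) where
  isP1Curve := h₁.isP1Curve.prod h₂.isP1Curve
  isWeakSolution := h₁.isWeakSolution.prod h₂.isWeakSolution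
    (fun t ht => ⟨(h₁.isP1Curve.isP1 t ht).1, (h₁.isP1Curve.isP1 t ht).2⟩)
    (fun t ht => ⟨(h₂.isP1Curve.isP1 t ht).1, (h₂.isP1Curve.isP1 t ht).2⟩)
  unique σ hσ hw h0 t ht := by
    have hp₁ := h₁.isP1Curve.isP1 0 le_rfl
    have hp₂ := h₂.isP1Curve.isP1 0 le_rfl
    have := hp₁.isProbabilityMeasure
    have := hp₂.isProbabilityMeasure
    obtain ⟨hprod, hw₁, hw₂⟩ := hw.fst_snd h₁.isWeakSolution.velocityDefined.differentiable
      h₂.isWeakSolution.velocityDefined.differentiable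
      (fun t ht => ⟨(hσ.isP1 t ht).1, (hσ.isP1 t ht).2⟩) hp₁.compl_null hp₂.compl_null h0
    rw [hprod t ht, h₁.unique _ (hσ.fst hU₁) hw₁ (by simp only [h0, Measure.fst_prod]) t ht,
      h₂.unique _ (hσ.snd hU₂) hw₂ (by simp only [h0, Measure.snd_prod]) t ht]

end Aggregation

end

theorem mainTheorem10
    {k₁ k₂ : ℕ}
    {M₁ : Type*} [MetricSpace M₁] [ChartedSpace (EuclideanSpace ℝ (Fin k₁)) M₁]
    [IsManifold (𝓡 k₁) ∞ M₁]
    [RiemannianBundle (fun x : M₁ => TangentSpace (𝓡 k₁) x)]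
    [IsContMDiffRiemannianBundle (𝓡 k₁) ∞ (EuclideanSpace ℝ (Fin k₁))
      (fun x : M₁ => TangentSpace (𝓡 k₁) x)]
    [IsRiemannianManifold (𝓡 k₁) M₁]
    [CompleteSpace M₁] [ConnectedSpace M₁] [SecondCountableTopology M₁]
    [MeasurableSpace M₁] [BorelSpace M₁]
    {M₂ : Type*} [MetricSpace M₂] [ChartedSpace (EuclideanSpace ℝ (Fin k₂)) M₂]
    [IsManifold (𝓡 k₂) ∞ M₂]
    [RiemannianBundle (fun x : M₂ => TangentSpace (𝓡 k₂) x)]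
    [IsContMDiffRiemannianBundle (𝓡 k₂) ∞ (EuclideanSpace ℝ (Fin k₂))
      (fun x : M₂ => TangentSpace (𝓡 k₂) x)]
    [IsRiemannianManifold (𝓡 k₂) M₂]
    [CompleteSpace M₂] [ConnectedSpace M₂] [SecondCountableTopology M₂]
    [MeasurableSpace M₂] [BorelSpace M₂]
    (U₁ : Set M₁) (hU₁ : IsOpen U₁) (hconv₁ : Aggregation.GeodesicallyConvex U₁)
    (U₂ : Set M₂) (hU₂ : IsOpen U₂) (hconv₂ : Aggregation.GeodesicallyConvex U₂)
    (ρ₁ : ℝ → Measure M₁)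
    (hρ₁ : Aggregation.IsUniqueSolution (𝓡 k₁) dist (Aggregation.quadraticPotential dist) U₁ ρ₁)
    (ρ₂ : ℝ → Measure M₂)
    (hρ₂ : Aggregation.IsUniqueSolution (𝓡 k₂) dist (Aggregation.quadraticPotential dist) U₂ ρ₂)
    (p : M₁) (hp : p ∈ U₁) (q : M₂) (hq : q ∈ U₂)
    (hcons₁ : Tendsto (fun t => Aggregation.wasserstein1 dist (ρ₁ t) (Measure.dirac p))
      atTop (𝓝 0))
    (hcons₂ : Tendsto (fun t => Aggregation.wasserstein1 dist (ρ₂ t) (Measure.dirac q))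
      atTop (𝓝 0))
    (hsupp : ∃ t₀ : ℝ, 0 < t₀ ∧ ∃ Q₁ ⊆ U₁, ∃ Q₂ ⊆ U₂, IsCompact Q₁ ∧ IsCompact Q₂ ∧
      ∀ t, t₀ ≤ t → Aggregation.suppIn U₁ (ρ₁ t) ⊆ Q₁ ∧ Aggregation.suppIn U₂ (ρ₂ t) ⊆ Q₂) :
    Aggregation.IsUniqueSolution ((𝓡 k₁).prod (𝓡 k₂)) Aggregation.prodDist
        (Aggregation.quadraticPotential Aggregation.prodDist) (U₁ ×ˢ U₂)
        (fun t => (ρ₁ t).prod (ρ₂ t)) ∧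
      Tendsto (fun t => Aggregation.wasserstein1 Aggregation.prodDist
        ((ρ₁ t).prod (ρ₂ t)) (Measure.dirac (p, q))) atTop (𝓝 0) := by
  rw [Aggregation.quadraticPotential_prodDist]
  refine ⟨Aggregation.IsUniqueSolution.prod hU₁.measurableSet hU₂.measurableSet hρ₁ hρ₂, ?_⟩
  rw [← Measure.dirac_prod_dirac]
  exact Aggregation.tendsto_wasserstein1_prod
    ((eventually_ge_atTop 0).mono fun t ht => (hρ₁.isP1Curve.isP1 t ht).isProbabilityMeasure)
    ((eventually_ge_atTop 0).mono fun t ht => (hρ₂.isP1Curve.isP1 t ht).isProbabilityMeasure)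
    hcons₁ hcons₂
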